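/- Consider an MTDC network: a connected simple graph on the buses $\{1,\dots,n\}$ with line resistances $R_{ij}=R_{ji}>0$, let $\mathcal L_R$ be its weighted Laplacian with edge weights $1/R_{ij}$, and let $c,k_P,k,\gamma>0$ be constants (common capacitance, droop gain, integral gain and communication gain). Consider the linear systems (slack) $c\dot{\tilde V}=-\tilde{\mathcal L}_R\tilde V$, $\;y=\tfrac1{\sqrt n}\tilde V$, where one bus (the slack bus) is grounded and $\tilde{\mathcal L}_R$ is $\mathcal L_R$ with the row and column of that bus deleted; (droop) $c\dot V=-(\mathcal L_R+k_PI)V$, $\;y=\tfrac1{\sqrt n}V$; (DAPI) $k\dot z=V-\gamma\mathcal L_R z$, $\;c\dot V=-z-(\mathcal L_R+k_PI)V$, $\;y=\tfrac1{\sqrt n}V$. Writing each as $\dot x=Ax$, $y=Hx$, let $B$ be the matrix that feeds a unit input directly into the voltages ($B=I$ for slack and droop, $B=\begin{bmatrix}0\\ I\end{bmatrix}$ for DAPI with state $(z,V)$; i.e. random initial voltages with identity covariance). With $G(s)=H(sI-A)^{-1}B$, the squared $\mathcal H_2$ norm is $\|\mathcal S\|_{\mathcal H_2}^2=\frac1{2\pi}\int_{-\infty}^{\infty}\operatorname{tr}\big(G(i\omega)^*G(i\omega)\big)\,d\omega$.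 The $d$-dimensional lattice is the graph with vertex set $\mathbb Z^d$ in which points at Euclidean distance $1$ are joined; its $h$-fuzz is obtained by joining in addition all pairs of distinct vertices at graph distance at most $h$. A finite network is called a $d$-dimensional lattice (or $h$-fuzz) network if its graph is isomorphic to a subgraph of the $d$-dimensional lattice (or of its $h$-fuzz). 1. Fix $c>0$, $h$ and $0<\underline R\le\overline R$. There are constants $a_1,a_2>0$, depending only on $c,h,\underline R,\overline R$, such that for every $n\ge2$, every $n$-bus $d$-dimensional lattice or $h$-fuzz network with $\underline R\le R_{ij}\le\overline R$ on all lines, and every choice of slack bus, the slack system is stable with finite $\mathcal H_2$ norm and $$\|\mathcal S_{\rm slack}\|_{\mathcal H_2}^2\ge a_1 n\quad(d=1),\qquad \|\mathcal S_{\rm slack}\|_{\mathcal H_2}^2\ge a_2\log n\quad(d=2).$$ In particular, for $d\in\{1,2\}$ the norm grows without bound as $n\to\infty$, uniformly over all such networks. 2. For every connected network, without any restriction on its topology, and all $c,k_P,k,\gamma>0$, the droop and DAPI systems are stable with finite $\mathcal H_2$ norms, and $$\|\mathcal S_{\rm droop}\|_{\mathcal H_2}^2\le\frac{c}{2k_P},\qquad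 \|\mathcal S_{\rm DAPI}\|_{\mathcal H_2}^2\le\frac{c}{2k_P}.$$ -/

import Mathlib

open scoped Matrix

namespace MTDC

/-! ### Linear time-invariant systems and the `H₂` norm -/

/-- A linear system `ẋ = A x + B w`, `y = H x` with state index `σ`, input index `ι` and
output index `o`. -/
structure LinSystem (σ ι o : Type) where
  A : Matrix σ σ ℝ
  B : Matrix σ ι ℝ
  H : Matrix o σ ℝ

namespace LinSystem

variable {σ ι o : Type} [Fintype σ] [DecidableEq σ] [Fintype ι] [Fintype o]

/-- All eigenvalues of the system matrix lie in the open left half plane. -/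
def IsHurwitz (S : LinSystem σ ι o) : Prop :=
  ∀ μ ∈ spectrum ℂ (S.A.map Complex.ofReal), μ.re < 0

/-- The transfer matrix `G(s) = H (s I - A)⁻¹ B`. -/
noncomputable def transfer (S : LinSystem σ ι o) (s : ℂ) : Matrix o ι ℂ :=
  S.H.map Complex.ofReal * (s • (1 : Matrix σ σ ℂ) - S.A.map Complex.ofReal)⁻¹ *
    S.B.map Complex.ofReal

/-- The integrand `tr (G(iω)* G(iω))`; this trace is a nonnegative real number. -/
noncomputable def h2Density (S : LinSystem σ ι o) (ω : ℝ) : ℝ :=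
  (Matrix.trace ((S.transfer (Complex.I * ω))ᴴ * S.transfer (Complex.I * ω))).re

/-- The squared `H₂` norm is a well-defined finite number: the system is stable and the defining
integral converges. -/
def HasH2Norm (S : LinSystem σ ι o) : Prop :=
  S.IsHurwitz ∧ MeasureTheory.Integrable S.h2Density

/-- The squared `H₂` norm `(1 / 2π) ∫ tr (G(iω)* G(iω)) dω`. -/
noncomputable def h2NormSq (S : LinSystem σ ι o) : ℝ :=
  1 / (2 * Real.pi) * ∫ ω : ℝ, S.h2Density ω

end LinSystem

/-! ### MTDC networks -/

/-- A connected network of buses `V` joined by resistive lines; the line `{i, j}` has resistance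
`R s(i, j) > 0` (values of `R` off the edge set are never used). -/
structure Network (V : Type) where
  graph : SimpleGraph V
  connected : graph.Connected
  R : Sym2 V → ℝ
  R_pos : ∀ e ∈ graph.edgeSet, 0 < R e

namespace Network

variable {V : Type} [Fintype V] [DecidableEq V]

open Classical in
/-- The conductance `1 / R i j` of the line `{i, j}`, and `0` if there is no such line. -/
noncomputable def conductance (N : Network V) (i j : V) : ℝ :=
  if N.graph.Adj i j then 1 / N.R s(i, j) else 0

/-- The weighted Laplacian matrix, with the conductances as edge weights. -/
noncomputable def laplacian (N : Network V) : Matrix V V ℝ :=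
  Matrix.diagonal (fun i => ∑ j, N.conductance i j) - Matrix.of N.conductance

/-- The resistances of all lines lie between `Rlo` and `Rhi`. -/
def ResistancesWithin (N : Network V) (Rlo Rhi : ℝ) : Prop :=
  ∀ e ∈ N.graph.edgeSet, Rlo ≤ N.R e ∧ N.R e ≤ Rhi

/-- Slack bus control, with bus `s` grounded: `C̃ Ṽ' = - L̃ Ṽ`, `y = Ṽ / √n`, where the tilde
deletes the row and the column of `s` and `n` is the number of all buses. The input acts as
`B = I` on the voltages (unit-covariance initial voltage perturbations). -/
noncomputable def slack (N : Network V) (s : V) (C : V → ℝ) :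
    LinSystem {i : V // i ≠ s} {i : V // i ≠ s} {i : V // i ≠ s} where
  A := -(Matrix.diagonal (fun i : {i : V // i ≠ s} => (C i)⁻¹) *
    N.laplacian.submatrix Subtype.val Subtype.val)
  B := 1
  H := (1 / √(Fintype.card V : ℝ)) • 1

/-- Droop control: `C V' = -(L + K_P) V`, `y = V / √n`, with input matrix `B = I` on the
voltages. -/
noncomputable def droop (N : Network V) (C KP : V → ℝ) : LinSystem V V V where
  A := -(Matrix.diagonal (fun i => (C i)⁻¹) * (N.laplacian + Matrix.diagonal KP))
  B := 1
  H := (1 / √(Fintype.card V : ℝ)) • 1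

/-- DAPI control with communication Laplacian `Lq` and state `(z, V)`:
`K z' = - Lq z + V`, `C V' = - z - (L + K_P) V`, `y = V / √n`, with input matrix `B = (0, I)`,
that is, the identity on the voltages. -/
noncomputable def dapi (N : Network V) (C KP K : V → ℝ) (Lq : Matrix V V ℝ) :
    LinSystem (V ⊕ V) V V where
  A := Matrix.fromBlocks
    (-(Matrix.diagonal (fun i => (K i)⁻¹) * Lq)) (Matrix.diagonal (fun i => (K i)⁻¹))
    (-Matrix.diagonal (fun i => (C i)⁻¹))
    (-(Matrix.diagonal (fun i => (C i)⁻¹) * (N.laplacian + Matrix.diagonal KP)))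
  B := Matrix.fromRows 0 1
  H := Matrix.fromCols 0 ((1 / √(Fintype.card V : ℝ)) • 1)

end Network

/-! ### Lattices and fuzzes -/

/-- The `d`-dimensional lattice: the nodes are the points of `ℤ^d`, and two nodes are joined when
their (squared) Euclidean distance is `1`. -/
def lattice (d : ℕ) : SimpleGraph (Fin d → ℤ) where
  Adj x y := ∑ i, (x i - y i) ^ 2 = 1
  symm := ⟨fun x y hxy => by
    rw [← hxy]
    exact Finset.sum_congr rfl fun i _ => by ring⟩
  loopless := ⟨fun x hx => by simp at hx⟩

/-- The `h`-fuzz of a graph: an edge is added between any two distinct nodes within graph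
distance `h`. For `h ≤ 1` this is the graph itself. -/
def fuzz {W : Type} (h : ℕ) (G : SimpleGraph W) : SimpleGraph W where
  Adj x y := G.Adj x y ∨ (x ≠ y ∧ G.edist x y ≤ h)
  symm := ⟨fun x y hxy => by
    rcases hxy with hxy | ⟨hne, hle⟩
    · exact Or.inl hxy.symm
    · exact Or.inr ⟨hne.symm, by rwa [SimpleGraph.edist_comm]⟩⟩
  loopless := ⟨fun x hx => by
    rcases hx with hx | ⟨hne, _⟩
    · exact G.loopless.irrefl x hx
    · exact hne rfl⟩

/-- A finite network over the `d`-dimensional lattice or its `h`-fuzz: its graph is (a copy of) a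
subgraph of that infinite graph. This covers the full finite lattices, their fuzzes, and every
other finite graph that is embedded in them. -/
def Network.IsLatticeNetwork {V : Type} (N : Network V) (d h : ℕ) : Prop :=
  N.graph.IsContained (fuzz h (lattice d))

end MTDC

/-!
The `H₂` norms are computed mode by mode. If the transfer matrix is a function of a real symmetric
matrix, the trace in the norm is a sum over its eigenvalues of squared moduli of scalar transfer
functions, and only two scalar integrals occur: `∫ 1 / (ω² + l²) = π / l` and
`∫ |(iω + a) / ((iω)² + q iω + p)|² = (π / q) (1 + a² / p)` (`integral_div_quadDenom`).

Droop and DAPI control: a Laplacian eigenvalue `λ ≥ 0` contributes `c / (2 (λ + kP))` under droop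
control, and under DAPI control at most that, since the integral state only adds damping. The
averages over the eigenvalues are therefore at most `c / (2 kP)`. Stability holds because the
characteristic polynomials of the modes have no root in the closed right half plane.

Slack control: the squared norm is `c tr(L̃⁻¹) / (2n)`, where the diagonal entries of `L̃⁻¹` are the
effective resistances to the slack bus. By Cauchy-Schwarz (Dirichlet's principle), a potential that
vanishes at the slack bus, equals `1` on half of the buses and has energy `E` shows
`tr(L̃⁻¹) ≥ n / (2 E)` (`card_div_le_trace_inv`). On a network inside a fuzz of `ℤ^d` a potential
that is a function of the sup-distance to the slack bus, with increments `w r` up to a radius `m`,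
has energy at most a constant divided by `∑ r ≤ m, w r`, provided that the spheres of `ℤ^d` of
radius `r` have `O(1 / w r)` points (`Network.le_slack_h2NormSq`). The largest radius `m` whose
ball contains at most half of the buses, with `w r = 1` for `d = 1` and `w r = 1 / (r + 1)` for
`d = 2`, yields the rates `n` and `log n`.
-/

namespace MTDC

open MeasureTheory Set Filter Topology

/-! ### Integrals of the squared moduli of scalar transfer functions -/

theorem integrable_inv_sq_add_sq {l : ℝ} (hl : 0 < l) :
    Integrable fun ω : ℝ => (ω ^ 2 + l ^ 2)⁻¹ := by
  have h := (integrable_inv_one_add_sq.comp_div hl.ne').const_mul (l ^ 2)⁻¹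
  refine h.congr (Eventually.of_forall fun ω => ?_)
  have : 0 < ω ^ 2 + l ^ 2 := by positivity
  simp only
  rw [← mul_inv]
  congr 1
  field_simp
  ring

theorem integral_inv_sq_add_sq {l : ℝ} (hl : 0 < l) :
    ∫ ω : ℝ, (ω ^ 2 + l ^ 2)⁻¹ = Real.pi / l := by
  have h := Measure.integral_comp_div (fun x : ℝ => (1 + x ^ 2)⁻¹) l
  rw [integral_univ_inv_one_add_sq, abs_of_pos hl, smul_eq_mul] at h
  have h2 : ∀ ω : ℝ, (ω ^ 2 + l ^ 2)⁻¹ = (l ^ 2)⁻¹ * (1 + (ω / l) ^ 2)⁻¹ := fun ω => by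
    rw [← mul_inv]
    congr 1
    field_simp
    ring
  simp_rw [h2]
  rw [integral_const_mul, h]
  field_simp

theorem integrable_of_even {f : ℝ → ℝ} (hf : ∀ x, f (-x) = f x)
    (h : IntegrableOn f (Ioi 0)) : Integrable f := by
  rw [← integrableOn_univ, ← Iic_union_Ioi (a := (0 : ℝ))]
  refine IntegrableOn.union ?_ h
  have h2 := (integrableOn_Ici_iff_integrableOn_Ioi (f := f) (b := (0 : ℝ)) (μ := volume)).2 h
  have h3 := (integrableOn_map_equiv (MeasurableEquiv.neg ℝ) (f := f) (μ := volume)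
    (s := Ici 0)).1 (by
      have : Measure.map (MeasurableEquiv.neg ℝ) volume = (volume : Measure ℝ) :=
        Measure.map_neg_eq_self _
      rwa [this])
  have h4 : (MeasurableEquiv.neg ℝ) ⁻¹' (Ici (0 : ℝ)) = Iic 0 := by
    ext x
    simp
  rw [h4] at h3
  exact h3.congr_fun (fun x _ => hf x) measurableSet_Iic

theorem integral_of_even {f : ℝ → ℝ} (hf : ∀ x, f (-x) = f x) :
    ∫ x, f x = 2 * ∫ x in Ioi 0, f x := by
  rw [← integral_comp_abs]
  refine integral_congr_ae (Eventually.of_forall fun x => ?_)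
  rcases abs_choice x with h | h <;> simp [h, hf]

/-- The squared modulus of `s² + q s + p` at `s = iω`. -/
noncomputable def quadDenom (p q ω : ℝ) : ℝ := (p - ω ^ 2) ^ 2 + q ^ 2 * ω ^ 2

theorem quadDenom_neg (p q ω : ℝ) : quadDenom p q (-ω) = quadDenom p q ω := by
  simp [quadDenom]

theorem quadDenom_pos {p q : ℝ} (hp : 0 < p) (hq : 0 < q) (ω : ℝ) : 0 < quadDenom p q ω := by
  unfold quadDenom
  rcases eq_or_ne ω 0 with rfl | h
  · simp; positivity
  · positivity

theorem continuous_quadDenom (p q : ℝ) : Continuous (quadDenom p q) := by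
  unfold quadDenom
  fun_prop

theorem hasDerivAt_arctan_quad {p q : ℝ} (hp : 0 < p) (hq : 0 < q) {ω : ℝ} (hω : 0 < ω) :
    HasDerivAt (fun ω => q⁻¹ * Real.arctan ((ω ^ 2 - p) / (q * ω)))
      ((p + ω ^ 2) / quadDenom p q ω) ω := by
  have h1 : HasDerivAt (fun ω : ℝ => (ω ^ 2 - p) / (q * ω))
      ((2 * ω * (q * ω) - (ω ^ 2 - p) * q) / (q * ω) ^ 2) ω := by
    have := ((hasDerivAt_pow 2 ω).sub_const p).div ((hasDerivAt_id ω).const_mul q)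
      (by positivity)
    exact this.congr_deriv (by simp)
  have h2 := (h1.arctan).const_mul q⁻¹
  refine h2.congr_deriv ?_
  have h3 := quadDenom_pos hp hq ω
  have h4 : 1 + ((ω ^ 2 - p) / (q * ω)) ^ 2 = quadDenom p q ω / (q * ω) ^ 2 := by
    unfold quadDenom
    field_simp
    ring
  rw [h4]
  field_simp
  ring

/-- Antiderivative on the half line of `(p + ω²) / |s² + q s + p|²`, extended to `0`
by its limit. -/
noncomputable def quadPrim (p q : ℝ) : ℝ → ℝ :=
  Function.update (fun ω => q⁻¹ * Real.arctan ((ω ^ 2 - p) / (q * ω))) 0 (q⁻¹ * -(Real.pi / 2))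

theorem hasDerivAt_quadPrim {p q : ℝ} (hp : 0 < p) (hq : 0 < q) {ω : ℝ} (hω : 0 < ω) :
    HasDerivAt (quadPrim p q) ((p + ω ^ 2) / quadDenom p q ω) ω := by
  refine (hasDerivAt_arctan_quad hp hq hω).congr_of_eventuallyEq ?_
  filter_upwards [Ioi_mem_nhds hω] with x hx
  exact Function.update_of_ne (ne_of_gt hx) _ _

theorem continuousWithinAt_quadPrim {p q : ℝ} (hp : 0 < p) (hq : 0 < q) :
    ContinuousWithinAt (quadPrim p q) (Ici 0) 0 := by
  unfold quadPrim
  rw [continuousWithinAt_update_same, Ici_sdiff_left]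
  refine Tendsto.const_mul _ ((Real.tendsto_arctan_atBot.mono_right nhdsWithin_le_nhds).comp ?_)
  have h1 : Tendsto (fun ω : ℝ => ω ^ 2 - p) (𝓝[>] 0) (𝓝 (0 ^ 2 - p)) :=
    ((continuous_pow 2).sub continuous_const).continuousAt.tendsto.mono_left nhdsWithin_le_nhds
  have h2 : Tendsto (fun ω : ℝ => q⁻¹ * ω⁻¹) (𝓝[>] 0) atTop :=
    tendsto_inv_nhdsGT_zero.const_mul_atTop (inv_pos.2 hq)
  refine (h1.neg_mul_atTop (by simpa using hp) h2).congr fun ω => ?_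
  rw [← mul_inv, div_eq_mul_inv]

theorem tendsto_quadPrim {p q : ℝ} (hq : 0 < q) :
    Tendsto (quadPrim p q) atTop (𝓝 (q⁻¹ * (Real.pi / 2))) := by
  have h0 : quadPrim p q =ᶠ[atTop] fun ω => q⁻¹ * Real.arctan ((ω ^ 2 - p) / (q * ω)) := by
    filter_upwards [eventually_gt_atTop 0] with x hx
    exact Function.update_of_ne (ne_of_gt hx) _ _
  refine Tendsto.congr' h0.symm ?_
  refine Tendsto.const_mul _ ((Real.tendsto_arctan_atTop.mono_right nhdsWithin_le_nhds).comp ?_)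
  have h1 : Tendsto (fun ω : ℝ => q⁻¹ * ω) atTop atTop :=
    tendsto_id.const_mul_atTop (inv_pos.2 hq)
  have h2 : Tendsto (fun ω : ℝ => -(p * q⁻¹) * ω⁻¹) atTop (𝓝 (-(p * q⁻¹) * 0)) :=
    tendsto_inv_atTop_zero.const_mul _
  refine (h1.atTop_add h2).congr' ?_
  filter_upwards [eventually_gt_atTop 0] with x hx
  field_simp
  ring

theorem integrableOn_add_sq_div_quadDenom {p q : ℝ} (hp : 0 < p) (hq : 0 < q) :
    IntegrableOn (fun ω => (p + ω ^ 2) / quadDenom p q ω) (Ioi 0) :=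
  integrableOn_Ioi_deriv_of_nonneg (continuousWithinAt_quadPrim hp hq)
    (fun _ hω => hasDerivAt_quadPrim hp hq hω)
    (fun ω _ => div_nonneg (by positivity) (quadDenom_pos hp hq ω).le) (tendsto_quadPrim hq)

theorem setIntegral_add_sq_div_quadDenom {p q : ℝ} (hp : 0 < p) (hq : 0 < q) :
    ∫ ω in Ioi 0, (p + ω ^ 2) / quadDenom p q ω = Real.pi / q := by
  rw [integral_Ioi_of_hasDerivAt_of_nonneg (continuousWithinAt_quadPrim hp hq)
    (fun _ hω => hasDerivAt_quadPrim hp hq hω)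
    (fun ω _ => div_nonneg (by positivity) (quadDenom_pos hp hq ω).le) (tendsto_quadPrim hq)]
  simp only [quadPrim, Function.update_self]
  ring

/-- The substitution `ω ↦ p / ω`, which leaves `|s² + q s + p|² / ω²` invariant. -/
theorem setIntegral_sq_div_quadDenom_eq {p q : ℝ} (hp : 0 < p) (hq : 0 < q) :
    ∫ ω in Ioi 0, ω ^ 2 / quadDenom p q ω = p * ∫ ω in Ioi 0, 1 / quadDenom p q ω := by
  have h1 := integral_comp_mul_left_Ioi' (fun ω => ω ^ 2 / quadDenom p q ω) 0 hp
  have h2 := integral_comp_rpow_Ioi (fun x => (p * x) ^ 2 / quadDenom p q (p * x))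
    (p := -1) (by norm_num)
  rw [mul_zero] at h1
  rw [← h1, ← h2, smul_eq_mul]
  congr 1
  refine setIntegral_congr_fun measurableSet_Ioi fun x hx => ?_
  have hx : 0 < x := hx
  have e1 : x ^ (-1 - 1 : ℝ) = (x ^ 2)⁻¹ := by
    rw [show (-1 - 1 : ℝ) = -(2 : ℕ) by norm_num, Real.rpow_neg hx.le, Real.rpow_natCast]
  have h3 := quadDenom_pos hp hq x
  have h5 : quadDenom p q (p * x⁻¹) = (p / x ^ 2) ^ 2 * quadDenom p q x := by
    unfold quadDenom
    field_simp
    ring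
  simp only [e1, Real.rpow_neg_one, smul_eq_mul, abs_neg, abs_one, one_mul]
  rw [h5]
  field_simp

theorem integrable_div_quadDenom {p q : ℝ} (hp : 0 < p) (hq : 0 < q) (a : ℝ) :
    Integrable fun ω => (ω ^ 2 + a ^ 2) / quadDenom p q ω := by
  have h := integrable_of_even (fun x => by simp [quadDenom_neg])
    (integrableOn_add_sq_div_quadDenom hp hq)
  refine (h.const_mul (1 + a ^ 2 / p)).mono'
    (((by fun_prop : Continuous fun ω : ℝ => ω ^ 2 + a ^ 2).div (continuous_quadDenom p q)
      fun ω => (quadDenom_pos hp hq ω).ne').aestronglyMeasurable)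
    (Eventually.of_forall fun ω => ?_)
  have h3 := quadDenom_pos hp hq ω
  rw [Real.norm_of_nonneg (by positivity), ← mul_div_assoc]
  gcongr
  have : (1 + a ^ 2 / p) * (p + ω ^ 2) = p + ω ^ 2 + a ^ 2 + a ^ 2 / p * ω ^ 2 := by
    field_simp
    ring
  rw [this]
  have : 0 ≤ a ^ 2 / p * ω ^ 2 := by positivity
  linarith

/-- The squared norm integral of `(s + a) / (s² + q s + p)`. It combines the two integrals with
numerators `ω²` and `1`: their sum with weights `1, p` has an arctangent antiderivative, and the
involution `ω ↦ p / ω` makes the two weighted terms equal. -/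
theorem integral_div_quadDenom {p q : ℝ} (hp : 0 < p) (hq : 0 < q) (a : ℝ) :
    ∫ ω, (ω ^ 2 + a ^ 2) / quadDenom p q ω = Real.pi / q * (1 + a ^ 2 / p) := by
  have i0 : IntegrableOn (fun ω => ω ^ 2 / quadDenom p q ω) (Ioi 0) := by
    simpa using (integrable_div_quadDenom hp hq 0).integrableOn (s := Ioi 0)
  have i1 : IntegrableOn (fun ω => 1 / quadDenom p q ω) (Ioi 0) := by
    refine ((integrable_div_quadDenom hp hq 1).integrableOn.sub i0).congr_fun (fun ω _ => ?_)
      measurableSet_Ioi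
    have := quadDenom_pos hp hq ω
    simp only [Pi.sub_apply]
    field_simp
    ring
  have split : ∀ b : ℝ, ∫ ω in Ioi 0, (ω ^ 2 + b) / quadDenom p q ω =
      (∫ ω in Ioi 0, ω ^ 2 / quadDenom p q ω) + b * ∫ ω in Ioi 0, 1 / quadDenom p q ω := by
    intro b
    rw [← integral_const_mul, ← integral_add i0 (i1.const_mul b)]
    refine setIntegral_congr_fun measurableSet_Ioi fun ω _ => ?_
    ring
  rw [integral_of_even (fun x => by simp [quadDenom_neg]), split]
  have h1 := split p
  simp only [add_comm _ p] at h1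
  rw [setIntegral_add_sq_div_quadDenom hp hq] at h1
  rw [setIntegral_sq_div_quadDenom_eq hp hq] at h1 ⊢
  have h2 : ∫ ω in Ioi 0, 1 / quadDenom p q ω = Real.pi / q / (2 * p) := by
    field_simp at h1 ⊢
    linarith
  rw [h2]
  field_simp

end MTDC

namespace MTDC

open MeasureTheory

/-! ### Diagonalized systems -/

section Spectral

variable {σ : Type} [Fintype σ] [DecidableEq σ]

/-- The functional calculus of a real symmetric matrix `M`: an algebra homomorphism `Φ` sending
the function `i ↦ λᵢ` on the eigenvalue indices to `M` and compatible with traces and adjoints. -/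
theorem exists_functionalCalculus {M : Matrix σ σ ℝ} (hM : M.IsHermitian) :
    ∃ Φ : (σ → ℂ) →ₐ[ℂ] Matrix σ σ ℂ,
      Φ (fun i => (hM.eigenvalues i : ℂ)) = M.map Complex.ofReal ∧
      (∀ f, Matrix.trace (Φ f) = ∑ i, f i) ∧ ∀ f, (Φ f)ᴴ = Φ (star f) := by
  set U : Matrix σ σ ℝ := (hM.eigenvectorUnitary : Matrix σ σ ℝ)
  have hU1 : star U * U = 1 := Unitary.coe_star_mul_self hM.eigenvectorUnitary
  have hU2 : U * star U = 1 := Unitary.coe_mul_star_self hM.eigenvectorUnitary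
  have hM' : M = U * Matrix.diagonal hM.eigenvalues * star U := by
    conv_lhs => rw [hM.spectral_theorem, Unitary.conjStarAlgAut_apply]
    rfl
  have hs : (star U).map Complex.ofReal = star (U.map Complex.ofReal) := by
    ext i j
    simp [Matrix.star_apply]
  have key : ∀ A B : Matrix σ σ ℝ, (A * B).map Complex.ofReal =
      A.map Complex.ofReal * B.map Complex.ofReal := fun A B =>
    Matrix.map_mul (f := Complex.ofRealHom)
  have one : (1 : Matrix σ σ ℝ).map Complex.ofReal = 1 :=
    Matrix.map_one _ Complex.ofReal_zero Complex.ofReal_one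
  have hV : U.map Complex.ofReal ∈ unitary (Matrix σ σ ℂ) := by
    rw [Unitary.mem_iff, ← hs, ← key, ← key, hU1, hU2, one]
    exact ⟨rfl, rfl⟩
  let W : unitary (Matrix σ σ ℂ) := ⟨_, hV⟩
  refine ⟨((Unitary.conjStarAlgAut ℂ (Matrix σ σ ℂ) W).toAlgEquiv : _ →ₐ[ℂ] _).comp
    (Matrix.diagonalAlgHom ℂ), ?_, fun f => ?_, fun f => ?_⟩
  · conv_rhs => rw [hM', key, key, hs]
    have : (Matrix.diagonal hM.eigenvalues).map Complex.ofReal =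
        Matrix.diagonal fun i => (hM.eigenvalues i : ℂ) := by
      rw [Matrix.diagonal_map Complex.ofReal_zero]
    rw [this]
    rfl
  · change Matrix.trace ((W : Matrix σ σ ℂ) * Matrix.diagonal f * star (W : Matrix σ σ ℂ)) = _
    rw [Matrix.trace_mul_comm, ← mul_assoc, Unitary.coe_star_mul_self, one_mul,
      Matrix.trace_diagonal]
  · change star ((W : Matrix σ σ ℂ) * Matrix.diagonal f * star (W : Matrix σ σ ℂ)) =
      (W : Matrix σ σ ℂ) * Matrix.diagonal (star f) * star (W : Matrix σ σ ℂ)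
    rw [star_mul, star_mul, star_star, mul_assoc, Matrix.star_eq_conjTranspose (Matrix.diagonal f),
      Matrix.diagonal_conjTranspose]

theorem functionalCalculus_const (Φ : (σ → ℂ) →ₐ[ℂ] Matrix σ σ ℂ) (s : ℂ) :
    Φ (fun _ => s) = s • (1 : Matrix σ σ ℂ) := by
  rw [← Algebra.algebraMap_eq_smul_one, ← Φ.commutes]
  rfl

theorem trace_inv_eq_sum_inv_eigenvalues {M : Matrix σ σ ℝ} (hM : M.PosDef) :
    Matrix.trace M⁻¹ = ∑ i, (hM.isHermitian.eigenvalues i)⁻¹ := by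
  obtain ⟨Φ, h1, h2, -⟩ := exists_functionalCalculus hM.isHermitian
  have key : ∀ A B : Matrix σ σ ℝ, (A * B).map Complex.ofReal =
      A.map Complex.ofReal * B.map Complex.ofReal := fun A B =>
    Matrix.map_mul (f := Complex.ofRealHom)
  have e1 : M.map Complex.ofReal * (M⁻¹).map Complex.ofReal = 1 := by
    rw [← key, Matrix.mul_nonsing_inv _ ((Matrix.isUnit_iff_isUnit_det _).1 hM.isUnit)]
    exact Matrix.map_one _ Complex.ofReal_zero Complex.ofReal_one
  have e2 : Φ (fun i => ((hM.isHermitian.eigenvalues i)⁻¹ : ℂ)) * M.map Complex.ofReal = 1 := by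
    rw [← h1, ← map_mul, ← map_one Φ]
    congr 1
    ext i
    have := (hM.eigenvalues_pos i).ne'
    simp [this]
  have e3 := left_inv_eq_right_inv e2 e1
  have e4 := congrArg Matrix.trace e3
  rw [h2] at e4
  have e5 : Matrix.trace ((M⁻¹).map Complex.ofReal) = ((Matrix.trace M⁻¹ : ℝ) : ℂ) := by
    simp [Matrix.trace]
  rw [e5] at e4
  exact_mod_cast e4.symm

/-- A trace bound of Dirichlet type: a test vector `f` that equals `1` on `F` and has quadratic
form `E` forces `tr M⁻¹ ≥ |F| / E`, since each `(M⁻¹)ᵢᵢ` with `i ∈ F` is at least `1 / E`. -/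
theorem card_div_le_trace_inv {M : Matrix σ σ ℝ} (hM : M.PosDef) (f : σ → ℝ) (F : Finset σ)
    (hF : ∀ i ∈ F, f i = 1) {E : ℝ} (hE : 0 < E) (hfE : f ⬝ᵥ M *ᵥ f ≤ E) :
    (F.card : ℝ) / E ≤ Matrix.trace M⁻¹ := by
  have hP := hM.inv.posSemidef
  have hinv : M⁻¹ * M = 1 := Matrix.nonsing_inv_mul _ ((Matrix.isUnit_iff_isUnit_det _).1 hM.isUnit)
  have hsymm : (M⁻¹)ᵀ = M⁻¹ := hM.inv.isHermitian
  have hdiag : ∀ i, 0 ≤ M⁻¹ i i := fun i => hP.diag_nonneg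
  have hbound : ∀ i ∈ F, 1 / E ≤ M⁻¹ i i := by
    intro i hi
    -- nonnegativity of the form of `M⁻¹` at `eᵢ - E⁻¹ M f`
    have h := hP.dotProduct_mulVec_nonneg (Pi.single i 1 - E⁻¹ • (M *ᵥ f))
    have a1 : M⁻¹ *ᵥ (M *ᵥ f) = f := by rw [Matrix.mulVec_mulVec, hinv, Matrix.one_mulVec]
    have a2 : (M *ᵥ f) ⬝ᵥ (M⁻¹ *ᵥ Pi.single i 1) = f i := by
      rw [Matrix.dotProduct_mulVec, ← Matrix.mulVec_transpose, hsymm, a1]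
      simp
    have a3 : (M *ᵥ f) ⬝ᵥ f = f ⬝ᵥ M *ᵥ f := dotProduct_comm _ _
    have a4 : (Pi.single i 1 : σ → ℝ) ⬝ᵥ (M⁻¹ *ᵥ Pi.single i 1) = M⁻¹ i i := by simp
    have a5 : (Pi.single i 1 : σ → ℝ) ⬝ᵥ f = f i := by simp
    simp only [star_trivial, Matrix.mulVec_sub, Matrix.mulVec_smul, sub_dotProduct,
      dotProduct_sub, smul_dotProduct, dotProduct_smul, a1, a2, a3, a4, a5, smul_eq_mul,
      hF i hi] at h
    have b : E⁻¹ * (E⁻¹ * (f ⬝ᵥ M *ᵥ f)) ≤ E⁻¹ * (E⁻¹ * E) := by gcongr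
    rw [inv_mul_cancel₀ hE.ne'] at b
    rw [one_div]
    linarith
  calc (F.card : ℝ) / E = ∑ i ∈ F, 1 / E := by rw [Finset.sum_const, nsmul_eq_mul]; ring
    _ ≤ ∑ i ∈ F, M⁻¹ i i := Finset.sum_le_sum hbound
    _ ≤ ∑ i, M⁻¹ i i := Finset.sum_le_sum_of_subset_of_nonneg (Finset.subset_univ _)
        fun i _ _ => hdiag i

end Spectral

namespace LinSystem

variable {σ ι o : Type} [Fintype σ] [DecidableEq σ] [Fintype ι] [Fintype o]

omit [Fintype ι] [Fintype o] in
theorem isHurwitz_of_right_inverse (S : LinSystem σ ι o)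
    (h : ∀ s : ℂ, 0 ≤ s.re → ∃ Y, (s • (1 : Matrix σ σ ℂ) - S.A.map Complex.ofReal) * Y = 1) :
    S.IsHurwitz := by
  intro μ hμ
  by_contra hre
  obtain ⟨Y, hY⟩ := h μ (not_lt.1 hre)
  rw [spectrum.mem_iff, Algebra.algebraMap_eq_smul_one] at hμ
  exact hμ (IsUnit.of_mul_eq_one _ hY)

theorem hasH2Norm_and_eq_of_density (S : LinSystem σ ι o) (hS : S.IsHurwitz) {κ : Type} [Fintype κ]
    {g : κ → ℝ → ℝ} (hg : ∀ i, Integrable (g i)) {N : ℝ}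
    (hd : S.h2Density = fun ω => 1 / N * ∑ i, g i ω) :
    S.HasH2Norm ∧ S.h2NormSq = 1 / N * ∑ i, 1 / (2 * Real.pi) * ∫ ω, g i ω := by
  refine ⟨⟨hS, ?_⟩, ?_⟩
  · rw [hd]
    exact (integrable_finsetSum _ fun i _ => hg i).const_mul _
  · rw [h2NormSq, hd, integral_const_mul, integral_finsetSum _ fun i _ => hg i, ← Finset.mul_sum]
    ring

/-- If the transfer matrix is a function of a fixed symmetric matrix (in the sense of the
functional calculus `Φ`), the density is the average of the squared moduli of its modes. -/
theorem h2Density_of_transfer {V : Type} [Fintype V] [DecidableEq V] (S : LinSystem σ V V)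
    {Φ : (V → ℂ) →ₐ[ℂ] Matrix V V ℂ}
    (htr : ∀ f, Matrix.trace (Φ f) = ∑ i, f i) (hst : ∀ f, (Φ f)ᴴ = Φ (star f)) {N : ℝ}
    (hN : 0 ≤ N) {g : ℝ → V → ℂ} {ω : ℝ}
    (h : S.transfer (Complex.I * ω) = ((1 / √N : ℝ) : ℂ) • Φ (g ω)) :
    S.h2Density ω = 1 / N * ∑ i, Complex.normSq (g ω i) := by
  rw [h2Density, h, Matrix.conjTranspose_smul, hst, smul_mul_smul_comm, ← map_mul,
    Matrix.trace_smul, htr, smul_eq_mul]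
  have e1 : star (((1 / √N : ℝ) : ℂ)) * ((1 / √N : ℝ) : ℂ) = ((1 / N : ℝ) : ℂ) := by
    rw [Complex.star_def, Complex.conj_ofReal, ← Complex.ofReal_mul]
    congr 1
    rw [div_mul_div_comm, Real.mul_self_sqrt hN, one_mul]
  have e2 : ∑ i, (star (g ω) * g ω) i = ((∑ i, Complex.normSq (g ω i) : ℝ) : ℂ) := by
    rw [Complex.ofReal_sum]
    exact Finset.sum_congr rfl fun i _ => (Complex.normSq_eq_conj_mul_self).symm
  rw [e1, e2, ← Complex.ofReal_mul, Complex.ofReal_re]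

/-- The gradient system `ẋ = -M x`, `y = x / √N`, with `M` diagonalized with positive
eigenvalues `lᵢ`: each of them contributes `1 / (2 lᵢ)` to the squared norm. -/
theorem hasH2Norm_and_eq_of_diagonalized {Φ : (σ → ℂ) →ₐ[ℂ] Matrix σ σ ℂ}
    (h2 : ∀ f, Matrix.trace (Φ f) = ∑ i, f i) (h3 : ∀ f, (Φ f)ᴴ = Φ (star f)) {N : ℝ}
    (hN : 0 ≤ N) {l : σ → ℝ} (hpos : ∀ i, 0 < l i) {S : LinSystem σ σ σ}
    (hA : S.A.map Complex.ofReal = -Φ (fun i => (l i : ℂ))) (hB : S.B = 1)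
    (hH : S.H = (1 / √N) • 1) :
    S.HasH2Norm ∧ S.h2NormSq = 1 / N * ∑ i, 1 / (2 * l i) := by
  have hinv : ∀ s : ℂ, 0 ≤ s.re → (s • (1 : Matrix σ σ ℂ) - S.A.map Complex.ofReal) *
      Φ (fun i => (s + l i)⁻¹) = 1 := by
    intro s hs
    have e : s • (1 : Matrix σ σ ℂ) - S.A.map Complex.ofReal = Φ (fun i => s + l i) := by
      rw [hA, sub_neg_eq_add, ← functionalCalculus_const Φ, ← map_add]
      rfl
    rw [e, ← map_mul, ← map_one Φ]
    congr 1
    ext i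
    refine mul_inv_cancel₀ fun h0 => ?_
    have := congrArg Complex.re h0
    simp at this
    linarith [hpos i]
  have htrans : ∀ ω : ℝ, S.transfer (Complex.I * ω) =
      ((1 / √N : ℝ) : ℂ) • Φ (fun i => (Complex.I * ω + l i)⁻¹) := by
    intro ω
    have e1 : (1 : Matrix σ σ ℝ).map Complex.ofReal = 1 :=
      Matrix.map_one _ Complex.ofReal_zero Complex.ofReal_one
    have e2 : ((1 / √N) • (1 : Matrix σ σ ℝ)).map Complex.ofReal = ((1 / √N : ℝ) : ℂ) • 1 := by
      ext i j
      by_cases h : i = j <;> simp [h]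
    rw [transfer, hB, hH, e1, e2, Matrix.inv_eq_right_inv (hinv _ (by simp)), smul_mul_assoc,
      one_mul, mul_one]
  have hden : S.h2Density = fun ω => 1 / N * ∑ i, (ω ^ 2 + l i ^ 2)⁻¹ := by
    funext ω
    rw [S.h2Density_of_transfer h2 h3 hN (g := fun ω i => (Complex.I * ω + l i)⁻¹) (htrans ω)]
    congr 1
    refine Finset.sum_congr rfl fun i _ => ?_
    rw [Complex.normSq_inv, Complex.normSq_apply]
    simp
    ring
  obtain ⟨k1, k2⟩ := S.hasH2Norm_and_eq_of_density
    (S.isHurwitz_of_right_inverse fun s hs => ⟨_, hinv s hs⟩)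
    (fun i => integrable_inv_sq_add_sq (hpos i)) hden
  refine ⟨k1, ?_⟩
  rw [k2]
  congr 1
  refine Finset.sum_congr rfl fun i _ => ?_
  rw [integral_inv_sq_add_sq (hpos i)]
  have := hpos i
  field_simp

end LinSystem

end MTDC

namespace MTDC

open MeasureTheory

/-! ### Network Laplacians -/

namespace Network

variable {V : Type}

theorem conductance_comm (N : Network V) (i j : V) : N.conductance i j = N.conductance j i := by
  unfold conductance
  rw [Sym2.eq_swap]
  by_cases h : N.graph.Adj i j
  · rw [if_pos h, if_pos h.symm]
  · rw [if_neg h, if_neg fun h' => h h'.symm]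

theorem conductance_nonneg (N : Network V) (i j : V) : 0 ≤ N.conductance i j := by
  unfold conductance
  split_ifs with h
  · exact one_div_nonneg.2 (N.R_pos _ h).le
  · exact le_rfl

theorem conductance_pos (N : Network V) {i j : V} (h : N.graph.Adj i j) :
    0 < N.conductance i j := by
  unfold conductance
  rw [if_pos h]
  exact one_div_pos.2 (N.R_pos _ h)

theorem conductance_le (N : Network V) {Rlo Rhi : ℝ} (hR : N.ResistancesWithin Rlo Rhi)
    (hlo : 0 < Rlo) (i j : V) : N.conductance i j ≤ 1 / Rlo := by
  unfold conductance
  split_ifs with h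
  · exact one_div_le_one_div_of_le hlo (hR _ h).1
  · positivity

variable [Fintype V] [DecidableEq V]

theorem isHermitian_laplacian (N : Network V) : N.laplacian.IsHermitian := by
  refine Matrix.IsHermitian.ext fun i j => ?_
  rcases eq_or_ne i j with rfl | h
  · simp
  · simp [laplacian, Matrix.diagonal_apply_ne _ h, Matrix.diagonal_apply_ne _ h.symm,
      N.conductance_comm i j]

theorem dotProduct_laplacian (N : Network V) (x : V → ℝ) :
    x ⬝ᵥ N.laplacian *ᵥ x = 1 / 2 * ∑ i, ∑ j, N.conductance i j * (x i - x j) ^ 2 := by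
  have e1 : x ⬝ᵥ N.laplacian *ᵥ x =
      ∑ i, ∑ j, (N.conductance i j * x i ^ 2 - N.conductance i j * (x i * x j)) := by
    rw [laplacian, Matrix.sub_mulVec, dotProduct_sub]
    simp only [Finset.sum_sub_distrib]
    simp only [dotProduct, Matrix.mulVec_diagonal]
    congr 1
    · refine Finset.sum_congr rfl fun i _ => ?_
      rw [Finset.sum_mul, Finset.mul_sum]
      exact Finset.sum_congr rfl fun j _ => by ring
    · refine Finset.sum_congr rfl fun i _ => ?_
      simp only [Matrix.mulVec, dotProduct, Matrix.of_apply, Finset.mul_sum]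
      exact Finset.sum_congr rfl fun j _ => by ring
  have e2 : x ⬝ᵥ N.laplacian *ᵥ x =
      ∑ i, ∑ j, (N.conductance i j * x j ^ 2 - N.conductance i j * (x i * x j)) := by
    rw [e1, Finset.sum_comm]
    refine Finset.sum_congr rfl fun i _ => Finset.sum_congr rfl fun j _ => ?_
    rw [N.conductance_comm j i]
    ring
  have e3 : x ⬝ᵥ N.laplacian *ᵥ x + x ⬝ᵥ N.laplacian *ᵥ x =
      ∑ i, ∑ j, N.conductance i j * (x i - x j) ^ 2 := by
    conv_lhs => rw [e1]
    rw [← e1]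
    nth_rewrite 2 [e2]
    rw [e1, ← Finset.sum_add_distrib]
    refine Finset.sum_congr rfl fun i _ => ?_
    rw [← Finset.sum_add_distrib]
    exact Finset.sum_congr rfl fun j _ => by ring
  linarith

theorem posSemidef_laplacian (N : Network V) : N.laplacian.PosSemidef := by
  refine .of_dotProduct_mulVec_nonneg N.isHermitian_laplacian fun x => ?_
  rw [star_trivial, N.dotProduct_laplacian]
  exact mul_nonneg (by norm_num) (Finset.sum_nonneg fun i _ => Finset.sum_nonneg fun j _ =>
    mul_nonneg (N.conductance_nonneg i j) (sq_nonneg _))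

/-- Connectedness: the Laplacian form vanishes only on constants. -/
theorem eq_of_dotProduct_laplacian_eq_zero (N : Network V) {x : V → ℝ}
    (hx : x ⬝ᵥ N.laplacian *ᵥ x = 0) (u v : V) : x u = x v := by
  rw [N.dotProduct_laplacian] at hx
  have hnn : ∀ i j, 0 ≤ N.conductance i j * (x i - x j) ^ 2 := fun i j =>
    mul_nonneg (N.conductance_nonneg i j) (sq_nonneg _)
  have h0 : ∑ i, ∑ j, N.conductance i j * (x i - x j) ^ 2 = 0 := by linarith
  have hadj : ∀ i j, N.graph.Adj i j → x i = x j := by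
    intro i j hij
    have h1 := (Finset.sum_eq_zero_iff_of_nonneg fun i _ =>
      Finset.sum_nonneg fun j _ => hnn i j).1 h0 i (Finset.mem_univ i)
    have h2 := (Finset.sum_eq_zero_iff_of_nonneg fun j _ => hnn i j).1 h1 j (Finset.mem_univ j)
    have h3 := (mul_eq_zero.1 h2).resolve_left (N.conductance_pos hij).ne'
    exact sub_eq_zero.1 (pow_eq_zero_iff two_ne_zero |>.1 h3)
  obtain ⟨p⟩ := N.connected.preconnected u v
  induction p with
  | nil => rfl
  | cons h _ ih => exact (hadj _ _ h).trans ih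

/-- The Laplacian with the row and the column of the bus `s` deleted. -/
noncomputable def groundedLaplacian (N : Network V) (s : V) :
    Matrix {i : V // i ≠ s} {i : V // i ≠ s} ℝ :=
  N.laplacian.submatrix Subtype.val Subtype.val

/-- Grounding the bus `s` restricts the Laplacian form to the potentials vanishing at `s`. -/
theorem dotProduct_groundedLaplacian (N : Network V) {s : V} {f : V → ℝ} (hf : f s = 0) :
    (fun i : {i : V // i ≠ s} => f i) ⬝ᵥ N.groundedLaplacian s *ᵥ (fun i => f i) =
      f ⬝ᵥ N.laplacian *ᵥ f := by
  simp only [dotProduct, Matrix.mulVec, groundedLaplacian, Matrix.submatrix_apply]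
  rw [Fintype.sum_eq_add_sum_subtype_ne _ s, hf, zero_mul, zero_add]
  refine Finset.sum_congr rfl fun i _ => ?_
  rw [Fintype.sum_eq_add_sum_subtype_ne _ s, hf, mul_zero, zero_add]

theorem posDef_groundedLaplacian (N : Network V) (s : V) : (N.groundedLaplacian s).PosDef := by
  refine .of_dotProduct_mulVec_pos (N.isHermitian_laplacian.submatrix _) fun x hx => ?_
  let f : V → ℝ := fun i => if h : i ≠ s then x ⟨i, h⟩ else 0
  have hfs : f s = 0 := by simp [f]
  have hfx : (fun i : {i : V // i ≠ s} => f i) = x := by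
    ext i
    simp [f, i.2]
  have h := N.dotProduct_groundedLaplacian hfs
  rw [hfx] at h
  rw [star_trivial, h]
  refine lt_of_le_of_ne (by simpa using N.posSemidef_laplacian.dotProduct_mulVec_nonneg f)
    fun h0 => hx ?_
  rw [← hfx]
  ext i
  rw [N.eq_of_dotProduct_laplacian_eq_zero h0.symm i s, hfs]
  rfl

/-! ### Squared norms of the three control schemes -/

/-- The squared norm under slack control is `c tr(L̃⁻¹) / (2n)`, an average effective
resistance to the slack bus. -/
theorem slack_hasH2Norm_and_eq (N : Network V) (s : V) {c : ℝ} (hc : 0 < c) :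
    (N.slack s fun _ => c).HasH2Norm ∧ (N.slack s fun _ => c).h2NormSq =
      c / (2 * Fintype.card V) * Matrix.trace (N.groundedLaplacian s)⁻¹ := by
  have hM := N.posDef_groundedLaplacian s
  obtain ⟨Φ, h1, h2, h3⟩ := exists_functionalCalculus hM.isHermitian
  have htr := trace_inv_eq_sum_inv_eigenvalues hM
  set l := hM.isHermitian.eigenvalues
  have hpos : ∀ i, 0 < l i := hM.eigenvalues_pos
  have hA : (N.slack s fun _ => c).A.map Complex.ofReal =
      -Φ (fun i => ((c⁻¹ * l i : ℝ) : ℂ)) := by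
    have e : (fun i => ((c⁻¹ * l i : ℝ) : ℂ)) = (c⁻¹ : ℂ) • fun i => (l i : ℂ) := by
      ext i
      simp
    rw [e, map_smul, h1]
    simp only [slack, ← Matrix.smul_eq_diagonal_mul]
    ext i j
    simp [groundedLaplacian]
  obtain ⟨k1, k2⟩ := LinSystem.hasH2Norm_and_eq_of_diagonalized h2 h3 (Nat.cast_nonneg _)
    (fun i => mul_pos (inv_pos.2 hc) (hpos i)) hA rfl rfl
  refine ⟨k1, ?_⟩
  rw [k2, htr, Finset.mul_sum, Finset.mul_sum]
  refine Finset.sum_congr rfl fun i _ => ?_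
  have := hpos i
  field_simp

omit [DecidableEq V] in
theorem one_div_mul_sum_le [Nonempty V] {g : V → ℝ} {b : ℝ} (h : ∀ i, g i ≤ b) :
    1 / (Fintype.card V : ℝ) * ∑ i, g i ≤ b := by
  have hn : (0 : ℝ) < Fintype.card V := by exact_mod_cast Fintype.card_pos
  rw [one_div, inv_mul_le_iff₀ hn]
  simpa using Finset.sum_le_sum fun i (_ : i ∈ Finset.univ) => h i

theorem droop_hasH2Norm_and_le (N : Network V) {c kP : ℝ} (hc : 0 < c) (hkP : 0 < kP) :
    (N.droop (fun _ => c) fun _ => kP).HasH2Norm ∧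
      (N.droop (fun _ => c) fun _ => kP).h2NormSq ≤ c / (2 * kP) := by
  have : Nonempty V := N.connected.nonempty
  obtain ⟨Φ, h1, h2, h3⟩ := exists_functionalCalculus N.isHermitian_laplacian
  set l := N.isHermitian_laplacian.eigenvalues
  have hl : ∀ i, 0 ≤ l i := N.posSemidef_laplacian.eigenvalues_nonneg
  have hA : (N.droop (fun _ => c) fun _ => kP).A.map Complex.ofReal =
      -Φ (fun i => ((c⁻¹ * (l i + kP) : ℝ) : ℂ)) := by
    have e : (fun i => ((c⁻¹ * (l i + kP) : ℝ) : ℂ)) =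
        (c⁻¹ : ℂ) • ((fun i => (l i : ℂ)) + fun _ => (kP : ℂ)) := by
      ext i
      simp
    rw [e, map_smul, map_add, h1, functionalCalculus_const]
    simp only [droop, ← Matrix.smul_eq_diagonal_mul]
    ext i j
    by_cases h : i = j <;> simp [h]
  obtain ⟨k1, k2⟩ := LinSystem.hasH2Norm_and_eq_of_diagonalized h2 h3 (Nat.cast_nonneg _)
    (fun i => mul_pos (inv_pos.2 hc) (add_pos_of_nonneg_of_pos (hl i) hkP)) hA rfl rfl
  refine ⟨k1, ?_⟩
  rw [k2]
  refine one_div_mul_sum_le fun i => ?_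
  have := hl i
  rw [div_le_div_iff₀ (by positivity) (by positivity)]
  field_simp
  linarith

end Network

/-- The characteristic polynomial of a DAPI mode has no root in the closed right half plane. -/
theorem dapi_denominator_ne_zero {a b e : ℝ} (ha : 0 ≤ a) (hb : 0 < b) (he : 0 < e) {s : ℂ}
    (hs : 0 ≤ s.re) : (s + a) * (s + b) + e ≠ 0 := by
  intro h0
  have h1 := congrArg (fun z => ((starRingEnd ℂ (s + a)) * z).re) h0
  have h2 : (starRingEnd ℂ (s + a)) * ((s + a) * (s + b) + e) =
      (Complex.normSq (s + a) : ℂ) * (s + b) + (starRingEnd ℂ (s + a)) * e := by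
    rw [Complex.normSq_eq_conj_mul_self]
    ring
  simp only [h2] at h1
  have h3 : Complex.normSq (s + a) * (s.re + b) + (s.re + a) * e = 0 := by
    simpa using h1
  have h4 : 0 ≤ (s.re + a) * e := by positivity
  have h5 := Complex.normSq_nonneg (s + a)
  have h6 : Complex.normSq (s + a) = 0 := by
    by_contra hne
    have : 0 < Complex.normSq (s + a) * (s.re + b) :=
      mul_pos (lt_of_le_of_ne h5 (Ne.symm hne)) (by linarith)
    linarith
  rw [Complex.normSq_eq_zero.1 h6, zero_mul, zero_add] at h0
  exact he.ne' (by exact_mod_cast h0)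

/-- The transfer function `(s + a) / ((s + a)(s + b) + e)` from the voltage input to the voltage
of one DAPI mode, at `s = iω`. -/
theorem normSq_dapi_mode {a b e : ℝ} (ω : ℝ) :
    Complex.normSq ((Complex.I * ω + a) / ((Complex.I * ω + a) * (Complex.I * ω + b) + e)) =
      (ω ^ 2 + a ^ 2) / quadDenom (a * b + e) (a + b) ω := by
  rw [Complex.normSq_div]
  congr 1
  · simp [Complex.normSq_apply]
    ring
  · simp [Complex.normSq_apply, quadDenom]
    ring

/-- A Laplacian eigenvalue `λ` gives a DAPI mode with `a = γ λ / k`, `b = (λ + kP) / c` and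
`e = 1 / (k c)`; its squared norm `(a b + e + a²) / (2 (a + b) (a b + e))` is at most the
value `1 / (2 b)` of the corresponding droop mode. -/
theorem Network.dapi_hasH2Norm_and_le {V : Type} [Fintype V] [DecidableEq V] (N : Network V)
    {c kP k γ : ℝ} (hc : 0 < c) (hkP : 0 < kP) (hk : 0 < k) (hγ : 0 < γ) :
    (N.dapi (fun _ => c) (fun _ => kP) (fun _ => k) (γ • N.laplacian)).HasH2Norm ∧
      (N.dapi (fun _ => c) (fun _ => kP) (fun _ => k) (γ • N.laplacian)).h2NormSq
        ≤ c / (2 * kP) := by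
  have : Nonempty V := N.connected.nonempty
  obtain ⟨Φ, h1, h2, h3⟩ := exists_functionalCalculus N.isHermitian_laplacian
  set l := N.isHermitian_laplacian.eigenvalues
  have hl : ∀ i, 0 ≤ l i := N.posSemidef_laplacian.eigenvalues_nonneg
  set S := N.dapi (fun _ => c) (fun _ => kP) (fun _ => k) (γ • N.laplacian) with hS
  let a : V → ℝ := fun i => k⁻¹ * γ * l i
  let b : V → ℝ := fun i => c⁻¹ * (l i + kP)
  let e : ℝ := k⁻¹ * c⁻¹
  have ha : ∀ i, 0 ≤ a i := fun i => mul_nonneg (by positivity) (hl i)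
  have hb : ∀ i, 0 < b i := fun i =>
    mul_pos (inv_pos.2 hc) (add_pos_of_nonneg_of_pos (hl i) hkP)
  have he : 0 < e := by positivity
  let D : ℂ → V → ℂ := fun s i => (s + a i) * (s + b i) + e
  have hD : ∀ s : ℂ, 0 ≤ s.re → ∀ i, D s i ≠ 0 := fun s hs i =>
    dapi_denominator_ne_zero (ha i) (hb i) he hs
  -- the four blocks of `s - A` commute, so it inverts like a `2 × 2` matrix of functions of `λ`
  have hsA : ∀ s : ℂ, s • (1 : Matrix (V ⊕ V) (V ⊕ V) ℂ) - S.A.map Complex.ofReal =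
      Matrix.fromBlocks (Φ fun i => s + a i) (Φ fun _ => -(k⁻¹ : ℂ))
        (Φ fun _ => (c⁻¹ : ℂ)) (Φ fun i => s + b i) := by
    intro s
    have ea : (fun i => s + (a i : ℂ)) =
        (fun _ => s) + ((k⁻¹ * γ : ℝ) : ℂ) • fun i => (l i : ℂ) := by
      ext i
      simp [a]
    have eb : (fun i => s + (b i : ℂ)) =
        (fun _ => s) + (c⁻¹ : ℂ) • ((fun i => (l i : ℂ)) + fun _ => (kP : ℂ)) := by
      ext i
      simp [b, mul_add]
    rw [ea, eb, map_add, map_add, map_smul, map_smul, map_add, h1]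
    simp only [functionalCalculus_const, hS, dapi, ← Matrix.smul_eq_diagonal_mul]
    ext i j
    rcases i with i | i <;> rcases j with j | j <;> by_cases h : i = j <;>
      simp [h] <;> ring
  let Y : ℂ → Matrix (V ⊕ V) (V ⊕ V) ℂ := fun s =>
    Matrix.fromBlocks (Φ fun i => (s + b i) / D s i) (Φ fun i => k⁻¹ / D s i)
      (Φ fun i => -c⁻¹ / D s i) (Φ fun i => (s + a i) / D s i)
  have hY : ∀ s : ℂ, 0 ≤ s.re →
      (s • (1 : Matrix (V ⊕ V) (V ⊕ V) ℂ) - S.A.map Complex.ofReal) * Y s = 1 := by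
    intro s hs
    rw [hsA, Matrix.fromBlocks_multiply, ← Matrix.fromBlocks_one]
    simp only [← map_mul, ← map_add]
    congr 1
    · rw [← map_one Φ]
      congr 1
      ext i
      have := hD s hs i
      simp only [Pi.add_apply, Pi.mul_apply, Pi.one_apply]
      rw [mul_div_assoc', mul_div_assoc', ← add_div, div_eq_one_iff_eq this]
      simp [D, e]
    · rw [← map_zero Φ]
      congr 1
      ext i
      simp only [Pi.add_apply, Pi.mul_apply, Pi.zero_apply, Complex.ofReal_inv]
      ring
    · rw [← map_zero Φ]
      congr 1
      ext i
      simp only [Pi.add_apply, Pi.mul_apply, Pi.zero_apply, Complex.ofReal_inv]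
      ring
    · rw [← map_one Φ]
      congr 1
      ext i
      have := hD s hs i
      simp only [Pi.add_apply, Pi.mul_apply, Pi.one_apply]
      rw [mul_div_assoc', mul_div_assoc', ← add_div, div_eq_one_iff_eq this]
      simp [D, e]
      ring
  have htrans : ∀ ω : ℝ, S.transfer (Complex.I * ω) =
      ((1 / √(Fintype.card V : ℝ) : ℝ) : ℂ) •
        Φ (fun i => (Complex.I * ω + a i) / D (Complex.I * ω) i) := by
    intro ω
    have eB : S.B.map Complex.ofReal = Matrix.fromRows 0 1 := by
      ext i j
      rcases i with i | i <;> by_cases h : i = j <;> simp [hS, dapi, h]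
    have eH : S.H.map Complex.ofReal =
        Matrix.fromCols 0 (((1 / √(Fintype.card V : ℝ) : ℝ) : ℂ) • 1) := by
      ext i j
      rcases j with j | j <;> by_cases h : i = j <;> simp [hS, dapi, h]
    rw [LinSystem.transfer, eB, eH, Matrix.inv_eq_right_inv (hY _ (by simp)),
      Matrix.fromCols_mul_fromBlocks, Matrix.fromCols_mul_fromRows]
    simp
  have hden : S.h2Density = fun ω => 1 / (Fintype.card V : ℝ) *
      ∑ i, (ω ^ 2 + a i ^ 2) / quadDenom (a i * b i + e) (a i + b i) ω := by
    funext ω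
    rw [S.h2Density_of_transfer h2 h3 (Nat.cast_nonneg _)
      (g := fun ω i => (Complex.I * ω + a i) / D (Complex.I * ω) i) (htrans ω)]
    congr 1
    exact Finset.sum_congr rfl fun i _ => normSq_dapi_mode ω
  have hp : ∀ i, 0 < a i * b i + e := fun i =>
    add_pos_of_nonneg_of_pos (mul_nonneg (ha i) (hb i).le) he
  have hq : ∀ i, 0 < a i + b i := fun i => add_pos_of_nonneg_of_pos (ha i) (hb i)
  obtain ⟨k1, k2⟩ := S.hasH2Norm_and_eq_of_density
    (S.isHurwitz_of_right_inverse fun s hs => ⟨_, hY s hs⟩)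
    (fun i => integrable_div_quadDenom (hp i) (hq i) (a i)) hden
  refine ⟨k1, ?_⟩
  rw [k2]
  refine one_div_mul_sum_le fun i => ?_
  rw [integral_div_quadDenom (hp i) (hq i)]
  have hpi := hp i
  have hqi := hq i
  have hbi := hb i
  -- the modal norm is largest when the integral state is undamped (`a = 0`)
  calc 1 / (2 * Real.pi) * (Real.pi / (a i + b i) * (1 + a i ^ 2 / (a i * b i + e)))
      = (a i * b i + e + a i ^ 2) / (2 * (a i + b i) * (a i * b i + e)) := by
        have := Real.pi_pos
        field_simp
    _ ≤ 1 / (2 * b i) := by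
        rw [div_le_div_iff₀ (by positivity) (by positivity)]
        nlinarith [mul_nonneg (ha i) he.le]
    _ ≤ c / (2 * kP) := by
        have := hl i
        rw [div_le_div_iff₀ (by positivity) (by positivity)]
        simp only [b]
        field_simp
        linarith

end MTDC

namespace MTDC

open MeasureTheory

/-! ### Grounded energy of a radial potential -/

/-- Slack control on a network with a height function `ρ` vanishing at the slack bus. If lines
change `ρ` by at most `H`, degrees are at most `D`, the level `ρ = r` has at most `K / w r` buses
and at least half of the buses have `ρ ≥ m`, then the squared norm is at least a constant times
`∑ r < m, w r`. The test potential is the truncated radial function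
`v ↦ ∑ r < min (ρ v) m, w r`, normalized. -/
theorem Network.le_slack_h2NormSq {n : ℕ} (N : Network (Fin n)) (s : Fin n) {c Rlo Rhi : ℝ}
    (hc : 0 < c) (hlo : 0 < Rlo) (hR : N.ResistancesWithin Rlo Rhi) (ρ : Fin n → ℕ)
    (hρs : ρ s = 0) {H D : ℕ} {K : ℝ} (hH : 0 < H) (hD : 0 < D) (hK : 0 < K)
    (hlip : ∀ i j, N.graph.Adj i j → ρ j ≤ ρ i + H)
    (hdeg : ∀ i, ∃ T : Finset (Fin n), T.card ≤ D ∧ ∀ j, N.graph.Adj i j → j ∈ T)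
    {w : ℕ → ℝ} (hw : ∀ r, 0 < w r) (hanti : Antitone w)
    (hlevel : ∀ r, ((Finset.univ.filter fun i => ρ i = r).card : ℝ) * w r ≤ K)
    {m : ℕ} (hm : 0 < m) (hhalf : 2 * (Finset.univ.filter fun i => ρ i < m).card ≤ n) :
    c * Rlo / (4 * (D * H ^ 2 * K)) * ∑ r ∈ Finset.range m, w r ≤
      (N.slack s fun _ => c).h2NormSq := by
  set g : ℕ → ℝ := fun t => ∑ r ∈ Finset.range (min t m), w r with hg
  set G : ℝ := ∑ r ∈ Finset.range m, w r with hG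
  have hGpos : 0 < G := Finset.sum_pos (fun r _ => hw r) ⟨0, Finset.mem_range.2 hm⟩
  have hn : (0 : ℝ) < n := by exact_mod_cast Fin.pos s
  -- one line changes the potential by at most `H` times the weight at its lower end
  have hstep : ∀ i j, ρ i ≤ ρ j → ρ j ≤ ρ i + H → ρ i < m →
      (g (ρ i) - g (ρ j)) ^ 2 ≤ (H * w (ρ i)) ^ 2 := by
    intro i j hij hji him
    have h1 : g (ρ j) - g (ρ i) = ∑ r ∈ Finset.Ico (min (ρ i) m) (min (ρ j) m), w r := by
      simp only [hg]
      rw [Finset.sum_Ico_eq_sub _ (by omega)]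
    have h2 : ∑ r ∈ Finset.Ico (min (ρ i) m) (min (ρ j) m), w r ≤ H * w (ρ i) := by
      calc _ ≤ ∑ r ∈ Finset.Ico (min (ρ i) m) (min (ρ j) m), w (ρ i) :=
            Finset.sum_le_sum fun r hr => hanti (by rw [Finset.mem_Ico] at hr; omega)
        _ = ((min (ρ j) m - min (ρ i) m : ℕ) : ℝ) * w (ρ i) := by simp
        _ ≤ H * w (ρ i) := by
            have : min (ρ j) m - min (ρ i) m ≤ H := by omega
            exact mul_le_mul_of_nonneg_right (by exact_mod_cast this) (hw _).le
    have h3 : 0 ≤ ∑ r ∈ Finset.Ico (min (ρ i) m) (min (ρ j) m), w r :=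
      Finset.sum_nonneg fun r _ => (hw r).le
    rw [← neg_sub, neg_sq, h1]
    exact pow_le_pow_left₀ h3 h2 2
  have hflat : ∀ i j, ρ i ≤ ρ j → m ≤ ρ i → g (ρ i) - g (ρ j) = 0 := by
    intro i j hij him
    simp only [hg]
    rw [min_eq_right him, min_eq_right (him.trans hij), sub_self]
  set f : Fin n → ℝ := fun i => g (ρ i) with hf
  -- orient every line towards larger `ρ`
  have horient : f ⬝ᵥ N.laplacian *ᵥ f ≤
      ∑ i, ∑ j, if ρ i ≤ ρ j then N.conductance i j * (f i - f j) ^ 2 else 0 := by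
    set a : Fin n → Fin n → ℝ := fun i j => N.conductance i j * (f i - f j) ^ 2 with ha
    have hsymm : ∀ i j, a i j = a j i := fun i j => by
      simp only [ha]
      rw [N.conductance_comm i j]
      ring
    have hnn : ∀ i j, 0 ≤ a i j := fun i j =>
      mul_nonneg (N.conductance_nonneg i j) (sq_nonneg _)
    have h1 : ∑ i, ∑ j, a i j ≤ ∑ i, ∑ j, ((if ρ i ≤ ρ j then a i j else 0) +
        if ρ j ≤ ρ i then a j i else 0) := by
      refine Finset.sum_le_sum fun i _ => Finset.sum_le_sum fun j _ => ?_
      rcases le_total (ρ i) (ρ j) with h | h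
      · rw [if_pos h]
        have : 0 ≤ if ρ j ≤ ρ i then a j i else 0 := by
          split_ifs
          exacts [hnn _ _, le_rfl]
        linarith
      · rw [if_pos h, hsymm i j]
        have : 0 ≤ if ρ i ≤ ρ j then a j i else 0 := by
          split_ifs
          exacts [hnn _ _, le_rfl]
        linarith
    simp only [Finset.sum_add_distrib] at h1
    rw [Finset.sum_comm (f := fun i j => if ρ j ≤ ρ i then a j i else 0)] at h1
    rw [N.dotProduct_laplacian]
    linarith
  have hrow : ∀ i, (∑ j, if ρ i ≤ ρ j then N.conductance i j * (f i - f j) ^ 2 else 0) ≤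
      if ρ i < m then D * (1 / Rlo * (H * w (ρ i)) ^ 2) else 0 := by
    intro i
    obtain ⟨T, hT, hTi⟩ := hdeg i
    have hzero : ∀ j, ¬ N.graph.Adj i j → N.conductance i j = 0 := fun j hj => if_neg hj
    split_ifs with him
    · calc _ = ∑ j ∈ T, if ρ i ≤ ρ j then N.conductance i j * (f i - f j) ^ 2 else 0 := by
            refine (Finset.sum_subset (Finset.subset_univ T) fun j _ hj => ?_).symm
            rw [hzero j fun h => hj (hTi j h), zero_mul, ite_self]
        _ ≤ ∑ j ∈ T, 1 / Rlo * (H * w (ρ i)) ^ 2 := by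
            refine Finset.sum_le_sum fun j _ => ?_
            split_ifs with hij
            · by_cases hadj : N.graph.Adj i j
              · exact mul_le_mul (N.conductance_le hR hlo i j)
                  (hstep i j hij (hlip i j hadj) him) (sq_nonneg _) (by positivity)
              · rw [hzero j hadj, zero_mul]
                positivity
            · positivity
        _ = T.card * (1 / Rlo * (H * w (ρ i)) ^ 2) := by simp
        _ ≤ D * (1 / Rlo * (H * w (ρ i)) ^ 2) := by gcongr
    · refine (Finset.sum_eq_zero fun j _ => ?_).le
      split_ifs with hij
      · simp only [hf]
        rw [hflat i j hij (not_lt.1 him)]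
        ring
      · rfl
  have henergy : f ⬝ᵥ N.laplacian *ᵥ f ≤ D * H ^ 2 * K / Rlo * G := by
    calc _ ≤ ∑ i, if ρ i < m then D * (1 / Rlo * (H * w (ρ i)) ^ 2) else 0 :=
          horient.trans (Finset.sum_le_sum fun i _ => hrow i)
      _ = ∑ i ∈ Finset.univ.filter fun i => ρ i < m, D * (1 / Rlo * (H * w (ρ i)) ^ 2) := by
          rw [Finset.sum_filter]
      _ = ∑ r ∈ Finset.range m, ∑ i ∈ (Finset.univ.filter fun i => ρ i < m).filter
            (fun i => ρ i = r), D * (1 / Rlo * (H * w (ρ i)) ^ 2) :=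
          (Finset.sum_fiberwise_of_maps_to (fun i hi => by simpa using hi) _).symm
      _ ≤ ∑ r ∈ Finset.range m, D * H ^ 2 * K / Rlo * w r := by
          refine Finset.sum_le_sum fun r hr => ?_
          have hr' : r < m := Finset.mem_range.1 hr
          have e1 : (Finset.univ.filter fun i => ρ i < m).filter (fun i => ρ i = r) =
              Finset.univ.filter fun i => ρ i = r := by
            ext i
            simp only [Finset.mem_filter, Finset.mem_univ, true_and]
            omega
          rw [e1, Finset.sum_congr rfl fun i hi => by rw [(Finset.mem_filter.1 hi).2],
            Finset.sum_const, nsmul_eq_mul]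
          have h1 := hlevel r
          have h2 := hw r
          calc _ = D * H ^ 2 / Rlo * w r *
                (((Finset.univ.filter fun i => ρ i = r).card : ℝ) * w r) := by ring
            _ ≤ D * H ^ 2 / Rlo * w r * K := by gcongr
            _ = _ := by ring
      _ = D * H ^ 2 * K / Rlo * G := by rw [← Finset.mul_sum]
  set C : ℝ := D * H ^ 2 * K / Rlo with hC
  have hCpos : 0 < C := by positivity
  let u : Fin n → ℝ := G⁻¹ • f
  have hus : u s = 0 := by simp [u, hf, hg, hρs]
  have huE : u ⬝ᵥ N.laplacian *ᵥ u ≤ C / G := by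
    simp only [u, Matrix.mulVec_smul, smul_dotProduct, dotProduct_smul, smul_eq_mul]
    calc _ ≤ G⁻¹ * (G⁻¹ * (C * G)) := by gcongr
      _ = C / G := by field_simp
  rw [← N.dotProduct_groundedLaplacian hus] at huE
  let F : Finset {i : Fin n // i ≠ s} := Finset.univ.filter fun i => m ≤ ρ i
  have htrace := card_div_le_trace_inv (N.posDef_groundedLaplacian s) _ F (fun i hi => by
    have him : m ≤ ρ i := (Finset.mem_filter.1 hi).2
    simp only [u, hf, hg, Pi.smul_apply, smul_eq_mul]
    rw [min_eq_right him]
    exact inv_mul_cancel₀ hGpos.ne') (div_pos hCpos hGpos) huE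
  have hF : n ≤ 2 * F.card := by
    have h1 : F.card = (Finset.univ.filter fun i : Fin n => m ≤ ρ i).card := by
      rw [← Finset.card_map (Function.Embedding.subtype _)]
      congr 1
      ext i
      simp only [F, Finset.mem_map, Finset.mem_filter, Finset.mem_univ, true_and,
        Function.Embedding.coe_subtype, Subtype.exists, exists_and_left, exists_prop]
      constructor
      · rintro ⟨j, hj, -, rfl⟩
        exact hj
      · intro h
        refine ⟨i, h, ?_, rfl⟩
        rintro rfl
        omega
    have h2 := Finset.card_filter_add_card_filter_not (s := (Finset.univ : Finset (Fin n)))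
      (fun i => ρ i < m)
    simp only [not_lt, Finset.card_univ, Fintype.card_fin] at h2
    omega
  have hF' : (n : ℝ) ≤ 2 * F.card := by exact_mod_cast hF
  rw [(N.slack_hasH2Norm_and_eq s hc).2, Fintype.card_fin]
  calc c * Rlo / (4 * (D * H ^ 2 * K)) * G = c / (2 * n) * ((n / 2) / (C / G)) := by
        rw [hC]
        field_simp
        ring
    _ ≤ c / (2 * n) * (F.card / (C / G)) := by
        gcongr
        linarith
    _ ≤ _ := by gcongr

/-! ### Metric geometry of lattices and their fuzzes -/

theorem lattice_adj_abs_le {d : ℕ} {x y : Fin d → ℤ} (h : (lattice d).Adj x y) (i : Fin d) :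
    |y i - x i| ≤ 1 := by
  have h1 : ∑ i, (x i - y i) ^ 2 = 1 := h
  have h2 := Finset.single_le_sum (f := fun i => (x i - y i) ^ 2) (fun i _ => sq_nonneg _)
    (Finset.mem_univ i)
  simp only [h1] at h2
  rw [abs_sub_comm]
  exact (sq_le_one_iff_abs_le_one _).1 h2

theorem lattice_walk_abs_le {d : ℕ} {x y : Fin d → ℤ} (p : (lattice d).Walk x y) (i : Fin d) :
    |y i - x i| ≤ p.length := by
  induction p with
  | nil => simp
  | @cons u v w h p ih =>
    have h1 := lattice_adj_abs_le h i
    have h2 := abs_sub_le (w i) (v i) (u i)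
    rw [SimpleGraph.Walk.length_cons]
    push_cast
    linarith

/-- The bound `h + 1` rather than `h` also covers the lattice edges of the `0`-fuzz. -/
theorem fuzz_lattice_adj_abs_le {d h : ℕ} {x y : Fin d → ℤ} (hxy : (fuzz h (lattice d)).Adj x y)
    (i : Fin d) : |y i - x i| ≤ ((h + 1 : ℕ) : ℤ) := by
  rcases hxy with hxy | ⟨-, hxy⟩
  · have := lattice_adj_abs_le hxy i
    push_cast
    linarith [Int.natCast_nonneg h]
  · obtain ⟨p, hp⟩ := SimpleGraph.exists_walk_of_edist_ne_top
      (ne_top_of_le_ne_top (ENat.natCast_ne_top h) hxy)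
    rw [← hp] at hxy
    have h1 : p.length ≤ h := by exact_mod_cast hxy
    have h2 := lattice_walk_abs_le p i
    push_cast
    linarith [(by exact_mod_cast h1 : (p.length : ℤ) ≤ h)]

/-- The sup-norm of an integer vector. -/
def supNorm {d : ℕ} (x : Fin d → ℤ) : ℕ := Finset.univ.sup fun i => (x i).natAbs

theorem supNorm_le_iff {d : ℕ} {x : Fin d → ℤ} {r : ℕ} :
    supNorm x ≤ r ↔ ∀ i, |x i| ≤ r := by
  rw [supNorm, Finset.sup_le_iff]
  refine forall_congr' fun i => ?_
  simp only [Finset.mem_univ, true_imp_iff, Int.abs_eq_natAbs, Nat.cast_le]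

/-- The sup-norm ball of radius `r` in `ℤ^d`. -/
noncomputable def box (d r : ℕ) : Finset (Fin d → ℤ) :=
  Fintype.piFinset fun _ => Finset.Icc (-(r : ℤ)) r

theorem mem_box {d r : ℕ} {x : Fin d → ℤ} : x ∈ box d r ↔ supNorm x ≤ r := by
  rw [supNorm_le_iff, box, Fintype.mem_piFinset]
  simp only [Finset.mem_Icc, abs_le]

theorem card_box (d r : ℕ) : (box d r).card = (2 * r + 1) ^ d := by
  rw [box, Fintype.card_piFinset]
  simp only [Int.card_Icc, Finset.prod_const, Finset.card_univ, Fintype.card_fin]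
  congr 1
  omega

theorem card_le_box {ι : Type} {d r : ℕ} (A : Finset ι) {ψ : ι → Fin d → ℤ}
    (hψ : Function.Injective ψ) (h : ∀ v ∈ A, supNorm (ψ v) ≤ r) : A.card ≤ (2 * r + 1) ^ d := by
  rw [← card_box d r]
  exact Finset.card_le_card_of_injOn ψ (fun v hv => mem_box.2 (h v hv)) hψ.injOn

theorem card_sphere_le {ι : Type} {d r : ℕ} (A : Finset ι) {ψ : ι → Fin d → ℤ}
    (hψ : Function.Injective ψ) (h : ∀ v ∈ A, supNorm (ψ v) = r + 1) :
    A.card + (2 * r + 1) ^ d ≤ (2 * (r + 1) + 1) ^ d := by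
  have hsub : box d r ⊆ box d (r + 1) := fun x hx => mem_box.2 ((mem_box.1 hx).trans (by omega))
  have h1 : A.card ≤ (box d (r + 1) \ box d r).card := by
    refine Finset.card_le_card_of_injOn ψ (fun v hv => ?_) hψ.injOn
    have := h v hv
    simp only [Finset.coe_sdiff, Set.mem_sdiff, Finset.mem_coe, mem_box]
    omega
  have h2 := Finset.card_sdiff_add_card_eq_card hsub
  rw [card_box, card_box] at h2
  omega

theorem supNorm_le_add {d : ℕ} {x y : Fin d → ℤ} {H : ℕ} (h : ∀ i, |y i - x i| ≤ H) :
    supNorm y ≤ supNorm x + H := by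
  rw [supNorm_le_iff]
  intro i
  have h1 := supNorm_le_iff.1 (le_refl (supNorm x)) i
  have h2 := abs_add_le (x i) (y i - x i)
  rw [add_sub_cancel] at h2
  push_cast
  linarith [h i]

/-- The bound of `Network.le_slack_h2NormSq` on a lattice network, with the sup-distance to the
slack bus as height. The weights `w` have to compensate the growth of the spheres of `ℤ^d`. -/
theorem Network.IsLatticeNetwork.le_slack_h2NormSq {n d h : ℕ} {N : Network (Fin n)} (s : Fin n)
    (hN : N.IsLatticeNetwork d h) {c Rlo Rhi : ℝ}
    (hc : 0 < c) (hlo : 0 < Rlo) (hR : N.ResistancesWithin Rlo Rhi)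
    {w : ℕ → ℝ} (hw : ∀ r, 0 < w r) (hanti : Antitone w) (hw0 : w 0 ≤ 8)
    (hsphere : ∀ r, (((2 * (r + 1) + 1) ^ d - (2 * r + 1) ^ d : ℕ) : ℝ) * w (r + 1) ≤ 8)
    {m : ℕ} (hhalf : 2 * (2 * m + 1) ^ d ≤ n) :
    c * Rlo / (4 * (((2 * (h + 1) + 1) ^ d : ℕ) * ((h + 1 : ℕ) : ℝ) ^ 2 * 8)) *
      ∑ r ∈ Finset.range (m + 1), w r ≤ (N.slack s fun _ => c).h2NormSq := by
  classical
  obtain ⟨φ⟩ := hN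
  -- the embedding, translated so that the bus `p` sits at the origin
  let ψ : Fin n → Fin n → Fin d → ℤ := fun p v => φ v - φ p
  have hψ : ∀ p, Function.Injective (ψ p) := fun p u v huv =>
    φ.injective (sub_left_injective huv)
  have hadj : ∀ i j, N.graph.Adj i j → ∀ t, |φ j t - φ i t| ≤ ((h + 1 : ℕ) : ℤ) :=
    fun i j hij t => fuzz_lattice_adj_abs_le (φ.toHom.map_adj hij) t
  refine N.le_slack_h2NormSq s hc hlo hR (fun v => supNorm (ψ s v)) ?_ (H := h + 1)
    (D := (2 * (h + 1) + 1) ^ d) (K := 8) (by omega) (by positivity) (by norm_num) ?_ ?_ hw hanti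
    ?_ (m := m + 1) (by omega) ?_
  · have : supNorm (ψ s s) ≤ 0 := supNorm_le_iff.2 fun i => by simp [ψ]
    omega
  · intro i j hij
    refine supNorm_le_add fun t => ?_
    simpa [ψ] using hadj i j hij t
  · intro i
    refine ⟨Finset.univ.filter fun j => N.graph.Adj i j, ?_, fun j hj => by simpa using hj⟩
    refine card_le_box _ (hψ i) fun j hj => supNorm_le_iff.2 fun t => ?_
    simpa [ψ] using hadj i j (Finset.mem_filter.1 hj).2 t
  · intro r
    have hw' := hw r
    rcases r with _ | r
    · have h1 := card_le_box (r := 0) (Finset.univ.filter fun v => supNorm (ψ s v) = 0) (hψ s)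
        fun v hv => ((Finset.mem_filter.1 hv).2).le
      have h2 : ((Finset.univ.filter fun v => supNorm (ψ s v) = 0).card : ℝ) ≤ 1 := by
        exact_mod_cast (by simpa using h1)
      nlinarith
    · have h1 := card_sphere_le (Finset.univ.filter fun v => supNorm (ψ s v) = r + 1) (hψ s)
        fun v hv => (Finset.mem_filter.1 hv).2
      refine le_trans (mul_le_mul_of_nonneg_right ?_ hw'.le) (hsphere r)
      exact_mod_cast (by omega)
  · have h1 := card_le_box (Finset.univ.filter fun v => supNorm (ψ s v) < m + 1) (hψ s)
      (r := m) fun v hv => Nat.lt_succ_iff.1 (Finset.mem_filter.1 hv).2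
    omega

end MTDC

namespace MTDC

/-! ### Growth rates in dimensions one and two -/

/-- The largest radius `m` for which a sup-norm ball of `ℤ^d` holds at most half of `n` buses. -/
theorem exists_maximal_box {d n : ℕ} (hd : d ≠ 0) (hn : 2 ≤ n) :
    ∃ m, 2 * (2 * m + 1) ^ d ≤ n ∧ n < 2 * (2 * m + 3) ^ d := by
  classical
  have hex : ∃ m, n < 2 * (2 * m + 3) ^ d :=
    ⟨n, by have := Nat.le_self_pow hd (2 * n + 3); omega⟩
  refine ⟨Nat.find hex, ?_, Nat.find_spec hex⟩
  rcases h : Nat.find hex with _ | m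
  · simpa using hn
  · have h1 := Nat.find_min hex (m := m) (by omega)
    simpa [mul_add] using h1

/-- In dimension one the spheres are bounded, so constant weights are admissible and the norm
grows like the radius `m ~ n / 4`. -/
theorem exists_linear_bound {c Rlo : ℝ} (hc : 0 < c) (hlo : 0 < Rlo) (h : ℕ) (Rhi : ℝ) :
    ∃ a : ℝ, 0 < a ∧ ∀ n : ℕ, 2 ≤ n → ∀ (N : Network (Fin n)) (s : Fin n),
      N.IsLatticeNetwork 1 h → N.ResistancesWithin Rlo Rhi →
        a * n ≤ (N.slack s fun _ => c).h2NormSq := by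
  refine ⟨c * Rlo / (4 * (((2 * (h + 1) + 1) ^ 1 : ℕ) * ((h + 1 : ℕ) : ℝ) ^ 2 * 8)) * (1 / 6),
    by positivity, fun n hn N s hN hR => ?_⟩
  obtain ⟨m, hm1, hm2⟩ := exists_maximal_box one_ne_zero hn
  refine le_trans ?_ (hN.le_slack_h2NormSq s hc hlo hR (w := fun _ => 1) (fun _ => one_pos)
    antitone_const (by norm_num) (fun r => ?_) hm1)
  · rw [mul_assoc]
    refine mul_le_mul_of_nonneg_left ?_ (by positivity)
    have : n ≤ 6 * (m + 1) := by
      rw [pow_one] at hm2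
      omega
    have : (n : ℝ) ≤ 6 * (m + 1) := by exact_mod_cast this
    simp only [Finset.sum_const, Finset.card_range, nsmul_eq_mul]
    push_cast
    linarith
  · have : (2 * (r + 1) + 1) ^ 1 - (2 * r + 1) ^ 1 = 2 := by
      rw [pow_one, pow_one]
      omega
    rw [this]
    norm_num

/-- In dimension two the sphere of radius `r` has about `8 r` points, so the weights `1 / (r + 1)`
are admissible and the norm grows like the harmonic sum up to the radius `m`, of order `√n`. -/
theorem exists_log_bound {c Rlo : ℝ} (hc : 0 < c) (hlo : 0 < Rlo) (h : ℕ) (Rhi : ℝ) :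
    ∃ a : ℝ, 0 < a ∧ ∀ n : ℕ, 2 ≤ n → ∀ (N : Network (Fin n)) (s : Fin n),
      N.IsLatticeNetwork 2 h → N.ResistancesWithin Rlo Rhi →
        a * Real.log n ≤ (N.slack s fun _ => c).h2NormSq := by
  refine ⟨c * Rlo / (4 * (((2 * (h + 1) + 1) ^ 2 : ℕ) * ((h + 1 : ℕ) : ℝ) ^ 2 * 8)) * (1 / 5),
    by positivity, fun n hn N s hN hR => ?_⟩
  obtain ⟨m, hm1, hm2⟩ := exists_maximal_box two_ne_zero hn
  refine le_trans ?_ (hN.le_slack_h2NormSq s hc hlo hR (w := fun r => (((r + 1 : ℕ) : ℝ))⁻¹)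
    (fun r => by positivity) (fun r t hrt => ?_) (by norm_num) (fun r => ?_) hm1)
  · rw [mul_assoc]
    refine mul_le_mul_of_nonneg_left ?_ (by positivity)
    -- `n < 2 (2 m + 3)² ≤ (m + 2)⁵` by the maximality of `m`
    have h1 : n ≤ (m + 2) ^ 5 := by
      have h2 : 2 ^ 3 ≤ (m + 2) ^ 3 := Nat.pow_le_pow_left (by omega) 3
      have h3 : 2 ^ 3 * (m + 2) ^ 2 ≤ (m + 2) ^ 3 * (m + 2) ^ 2 := Nat.mul_le_mul_right _ h2
      nlinarith
    have h4 : Real.log n ≤ 5 * Real.log ((m + 2 : ℕ) : ℝ) := by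
      have h5 : (n : ℝ) ≤ ((m + 2 : ℕ) : ℝ) ^ 5 := by exact_mod_cast h1
      have h6 := Real.log_le_log (by exact_mod_cast (by omega : 0 < n)) h5
      rw [Real.log_pow] at h6
      exact_mod_cast h6
    have h7 := log_add_one_le_harmonic (m + 1)
    have h8 : ((harmonic (m + 1) : ℚ) : ℝ) =
        ∑ r ∈ Finset.range (m + 1), (((r + 1 : ℕ) : ℝ))⁻¹ := by
      simp [harmonic]
    rw [h8] at h7
    linarith
  · exact inv_anti₀ (by positivity) (by exact_mod_cast (by omega))
  · have : (2 * (r + 1) + 1) ^ 2 - (2 * r + 1) ^ 2 = 8 * (r + 1) :=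
      Nat.sub_eq_of_eq_add (by ring)
    rw [this, ← div_eq_mul_inv, div_le_iff₀ (by positivity)]
    push_cast
    linarith

end MTDC

theorem theorem2 (c : ℝ) (hc : 0 < c) :
    -- slack bus control on lattices and fuzzes with uniformly bounded resistances
    (∀ (h : ℕ) (Rlo Rhi : ℝ), 0 < Rlo →
      -- dimension one
      (∃ a₁ : ℝ, 0 < a₁ ∧ ∀ (n : ℕ), 2 ≤ n → ∀ (N : MTDC.Network (Fin n)) (s : Fin n),
        N.IsLatticeNetwork 1 h → N.ResistancesWithin Rlo Rhi →
          (N.slack s (fun _ => c)).HasH2Norm ∧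
          a₁ * (n : ℝ) ≤ (N.slack s (fun _ => c)).h2NormSq) ∧
      -- dimension two
      (∃ a₂ : ℝ, 0 < a₂ ∧ ∀ (n : ℕ), 2 ≤ n → ∀ (N : MTDC.Network (Fin n)) (s : Fin n),
        N.IsLatticeNetwork 2 h → N.ResistancesWithin Rlo Rhi →
          (N.slack s (fun _ => c)).HasH2Norm ∧
          a₂ * Real.log (n : ℝ) ≤ (N.slack s (fun _ => c)).h2NormSq) ∧
      -- unbounded growth in both dimensions
      (∀ d : ℕ, d = 1 ∨ d = 2 → ∀ M : ℝ, ∃ n₀ : ℕ, ∀ (n : ℕ), n₀ ≤ n →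
        ∀ (N : MTDC.Network (Fin n)) (s : Fin n),
          N.IsLatticeNetwork d h → N.ResistancesWithin Rlo Rhi →
            M ≤ (N.slack s (fun _ => c)).h2NormSq)) ∧
    -- droop and DAPI control on an arbitrary connected network
    (∀ (kP k γ : ℝ), 0 < kP → 0 < k → 0 < γ → ∀ (n : ℕ) (N : MTDC.Network (Fin n)),
      ((N.droop (fun _ => c) (fun _ => kP)).HasH2Norm ∧
        (N.droop (fun _ => c) (fun _ => kP)).h2NormSq ≤ c / (2 * kP)) ∧
      ((N.dapi (fun _ => c) (fun _ => kP) (fun _ => k) (γ • N.laplacian)).HasH2Norm ∧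
        (N.dapi (fun _ => c) (fun _ => kP) (fun _ => k) (γ • N.laplacian)).h2NormSq
          ≤ c / (2 * kP))) := by 
  refine ⟨fun h Rlo Rhi hlo => ?_, fun kP k γ hkP hk hγ n N =>
    ⟨N.droop_hasH2Norm_and_le hc hkP, N.dapi_hasH2Norm_and_le hc hkP hk hγ⟩⟩
  obtain ⟨a₁, ha₁, h₁⟩ := MTDC.exists_linear_bound hc hlo h Rhi
  obtain ⟨a₂, ha₂, h₂⟩ := MTDC.exists_log_bound hc hlo h Rhi
  refine ⟨⟨a₁, ha₁, fun n hn N s hN hR => ⟨(N.slack_hasH2Norm_and_eq s hc).1, h₁ n hn N s hN hR⟩⟩,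
    ⟨a₂, ha₂, fun n hn N s hN hR => ⟨(N.slack_hasH2Norm_and_eq s hc).1, h₂ n hn N s hN hR⟩⟩,
    fun d hd M => ?_⟩
  rcases hd with rfl | rfl
  · have ht : Filter.Tendsto (fun n : ℕ => a₁ * (n : ℝ)) Filter.atTop Filter.atTop :=
      tendsto_natCast_atTop_atTop.const_mul_atTop ha₁
    obtain ⟨n₀, hn₀⟩ := Filter.eventually_atTop.1
      ((ht.eventually_ge_atTop M).and (Filter.eventually_ge_atTop 2))
    exact ⟨n₀, fun n hn N s hN hR =>
      (hn₀ n hn).1.trans (h₁ n (hn₀ n hn).2 N s hN hR)⟩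
  · have ht : Filter.Tendsto (fun n : ℕ => a₂ * Real.log n) Filter.atTop Filter.atTop :=
      (Real.tendsto_log_atTop.comp tendsto_natCast_atTop_atTop).const_mul_atTop ha₂
    obtain ⟨n₀, hn₀⟩ := Filter.eventually_atTop.1
      ((ht.eventually_ge_atTop M).and (Filter.eventually_ge_atTop 2))
    exact ⟨n₀, fun n hn N s hN hR =>
      (hn₀ n hn).1.trans (h₂ n (hn₀ n hn).2 N s hN hR)⟩
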